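/- For a finite simple graph $G$ and $S\subseteq V(G)$, let $\delta(S)=\{v\in V(G)\setminus S : v \text{ has a neighbour in } S\}$ be the vertex-border of $S$. For $0\le s\le |V(G)|$ put $\Phi_V(G,s)=\min_{|S|=s}|\delta(S)|$, and let $\Phi_V(G)=\max_{0\le s\le |V(G)|}\Phi_V(G,s)$ be the vertex-isoperimetric peak of $G$. **Theorem.** Let $q\in\{3,4\}$ and $d\ge 1$, and let $T$ be the complete $q$-ary tree of depth $d$, that is, the rooted tree in which every vertex at distance less than $d$ from the root has exactly $q$ children and every vertex at distance $d$ from the root is a leaf. Then, for some $\varepsilon\in[-1-\log_q 2,\;3]$, $$\Phi_V(T)=d-\log_q(d)+\varepsilon .$$ More precisely, $$d-\lceil\log_q(2d)\rceil\;\le\;\Phi_V(T)\;\le\;d-\lfloor\log_q(d)\rfloor+2 .$$ -/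

import Mathlib

/-- The vertices of the complete `q`-ary tree of depth `d`: words of length at most `d` over an
alphabet with `q` letters. The empty word is the root, the length of a word is its distance to the
root, and the children of a word `w` with fewer than `d` letters are the `q` words `a :: w`. -/
abbrev CompleteTreeVertex (q d : ℕ) : Type := {w : List (Fin q) // w.length ≤ d}

noncomputable instance instFintypeCompleteTreeVertex (q d : ℕ) :
    Fintype (CompleteTreeVertex q d) :=
  (List.finite_length_le (Fin q) d).fintype

/-- The complete `q`-ary tree of depth `d` as a simple graph: two vertices are adjacent when one of
them is a child of the other. -/
def completeTree (q d : ℕ) : SimpleGraph (CompleteTreeVertex q d) where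
  Adj v w := (∃ a : Fin q, w.1 = a :: v.1) ∨ (∃ a : Fin q, v.1 = a :: w.1)
  symm := ⟨fun _ _ h => h.symm⟩
  loopless := ⟨by
    intro v h
    rcases h with ⟨a, h⟩ | ⟨a, h⟩ <;> simpa using congrArg List.length h⟩

open Classical in
/-- The vertex-border `δ(S)`: the vertices outside `S` that have a neighbour in `S`. -/
noncomputable def vertexBorder {V : Type*} [Fintype V] (G : SimpleGraph V) (S : Finset V) :
    Finset V :=
  Finset.univ.filter fun v => v ∉ S ∧ ∃ u ∈ S, G.Adj v u

/-- The vertex-isoperimetric parameter `Φ_V(G, s)`: the minimum of `|δ(S)|` over the sets `S` of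
exactly `s` vertices. Such sets exist for `s ≤ |V(G)|`, the only values of `s` used below. -/
noncomputable def vertexIsoParam {V : Type*} [Fintype V] (G : SimpleGraph V) (s : ℕ) : ℕ :=
  sInf {k : ℕ | ∃ S : Finset V, S.card = s ∧ (vertexBorder G S).card = k}

/-- The vertex-isoperimetric peak `Φ_V(G)`: the maximum of `Φ_V(G, s)` over `0 ≤ s ≤ |V(G)|`. -/
noncomputable def vertexIsoPeak {V : Type*} [Fintype V] (G : SimpleGraph V) : ℕ :=
  (Finset.range (Fintype.card V + 1)).sup fun s => vertexIsoParam G s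

/-! Write N_j = (q^j - 1)/(q - 1) for the size of a tree with j layers.

Lower bound. Cutting along the border writes |S| as a signed combination of subtree sizes
(`exists_card_eq_sum_vertexBorder`). Hence (q - 1)|S| is, up to an error linear in d, a sum of one
term e·q^h with |e| ≤ q per border vertex, plus possibly q^(d+1). For |S| near q^(d+1)/(q - 1)^2 the
target is q^(d+1)/(q - 1), whose base-q digits are all 1, so essentially every position costs a term
(`le_card_add_of_dvd`). Only the lowest positions, about log_q(2qd) of them, drown in the error.

Upper bound. Descending one path and filling whole subtrees beside it realises every size with about
one border vertex per level. Treating two levels together (`exists_transition_two`) either saves a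
border vertex or leaves a freedom of one unit in the size. Once the collected freedom reaches N_i,
the bottom i levels can be matched approximately with a single border vertex
(`exists_isReachable_near`). `exists_isReachable` balances the two gains; together they save about
log_q d. -/

/-! ### Words and subtree sizes -/

/-- The words of length at most `d` over an alphabet with `q` letters. -/
def words (q : ℕ) : ℕ → Finset (List (Fin q))
  | 0 => {[]}
  | d + 1 => insert [] ((Finset.univ ×ˢ words q d).image fun p => p.1 :: p.2)

theorem mem_words {q d : ℕ} {w : List (Fin q)} : w ∈ words q d ↔ w.length ≤ d := by
  induction d generalizing w with
  | zero => simp [words]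
  | succ d ih => cases w <;> simp [words, ih]

theorem sum_words_succ {M : Type*} [AddCommMonoid M] {q d : ℕ} (f : List (Fin q) → M) :
    ∑ w ∈ words q (d + 1), f w = f [] + ∑ a, ∑ w ∈ words q d, f (a :: w) := by
  rw [words, Finset.sum_insert (by simp), Finset.sum_image (by
    rintro ⟨a, v⟩ _ ⟨b, w⟩ _ h
    simpa using h), Finset.sum_product]

/-- A sum over all words, in terms of the children of all words that have children. -/
theorem sum_words_eq_sum_children {M : Type*} [AddCommMonoid M] {q d : ℕ}
    (f : List (Fin q) → M) :
    ∑ w ∈ words q d, f w =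
      f [] + ∑ w ∈ words q d, if w.length < d then ∑ a, f (a :: w) else 0 := by
  cases d with
  | zero => simp [words]
  | succ d =>
    rw [sum_words_succ, Finset.sum_comm, ← Finset.sum_filter]
    congr 2
    ext w
    simp only [Finset.mem_filter, mem_words]
    omega

theorem sum_completeTreeVertex {M : Type*} [AddCommMonoid M] {q d : ℕ}
    (f : List (Fin q) → M) :
    ∑ v : CompleteTreeVertex q d, f v.1 = ∑ w ∈ words q d, f w :=
  (Finset.sum_subtype (words q d) (fun _ => mem_words) f).symm

/-- The number `1 + q + ⋯ + q ^ (j - 1)` of vertices of the complete `q`-ary tree with `j` layers. -/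
def treeSize (q : ℕ) : ℕ → ℕ
  | 0 => 0
  | j + 1 => q * treeSize q j + 1

theorem sub_one_mul_treeSize (q j : ℕ) : ((q : ℤ) - 1) * treeSize q j = q ^ j - 1 := by
  induction j with
  | zero => simp [treeSize]
  | succ j ih =>
    simp only [treeSize, pow_succ]
    push_cast
    linear_combination (q : ℤ) * ih

theorem card_words (q d : ℕ) : (words q d).card = treeSize q (d + 1) := by
  induction d with
  | zero => simp [words, treeSize]
  | succ d ih =>
    rw [Finset.card_eq_sum_ones, sum_words_succ, treeSize, ← ih]
    simp [add_comm]

theorem card_completeTreeVertex (q d : ℕ) :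
    Fintype.card (CompleteTreeVertex q d) = treeSize q (d + 1) := by
  rw [← card_words, Finset.card_eq_sum_ones, ← sum_completeTreeVertex fun _ => 1]
  simp

/-! ### The lower bound -/

/-- A telescoping identity: every vertex counts the size of its subtree minus the sizes of the
subtrees of its children. -/
theorem sum_words_telescope {q d : ℕ} (g : List (Fin q) → ℤ) :
    ∑ v ∈ words q d, g v = g [] * treeSize q (d + 1) +
      ∑ v ∈ words q d, treeSize q (d - v.length) *
        (if v.length < d then ∑ a, g (a :: v) - q * g v else 0) := by
  have h := sum_words_eq_sum_children (d := d) fun v => g v * (treeSize q (d + 1 - v.length) : ℤ)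
  -- Uses 1 = N_(j+1) - q·N_j at each vertex.
  have h2 : ∀ v ∈ words q d, g v * (treeSize q (d + 1 - v.length) : ℤ) =
      g v + q * (g v * treeSize q (d - v.length)) := by
    intro v hv
    rw [mem_words] at hv
    rw [Nat.succ_sub hv, treeSize]
    push_cast
    ring
  rw [Finset.sum_congr rfl h2, Finset.sum_add_distrib] at h
  simp only [List.length_nil, Nat.sub_zero, List.length_cons, Nat.add_sub_add_right] at h
  rw [← eq_sub_iff_add_eq] at h
  rw [h, add_sub_assoc, ← Finset.sum_sub_distrib]
  congr 1
  refine Finset.sum_congr rfl fun v hv => ?_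
  split_ifs with hlt
  · rw [← Finset.sum_mul]
    ring
  · rw [mem_words] at hv
    rw [Nat.sub_eq_zero_of_le (by omega)]
    simp [treeSize]

/-- Base-q carrying: strip the terms with exponent 0 and divide by q. As `w` stays a nonmultiple of
q - 1, each division either uses up a term or lowers the quotient |w| / (q - 1). -/
theorem le_card_add_of_dvd {ι : Type*} {q : ℕ} (hq : 3 ≤ q) (L : ℕ) (B : Finset ι)
    (e : ι → ℤ) (h : ι → ℕ) (he : ∀ i ∈ B, |e i| ≤ q) (w : ℤ) (hw : ¬ ((q : ℤ) - 1) ∣ w)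
    (hdvd : (q : ℤ) ^ L ∣ w - (q - 1) * ∑ i ∈ B, e i * q ^ h i) :
    (L : ℤ) ≤ B.card + |w| / (q - 1) := by
  have hq' : (3 : ℤ) ≤ q := by exact_mod_cast hq
  induction L generalizing B h w with
  | zero =>
    have : 0 ≤ |w| / ((q : ℤ) - 1) := Int.ediv_nonneg (abs_nonneg _) (by omega)
    push_cast
    omega
  | succ L ih =>
    set σ := ∑ i ∈ B.filter (fun i => h i = 0), e i with hσ
    have hsum : ∑ i ∈ B, e i * (q : ℤ) ^ h i =
        σ + q * ∑ i ∈ B.filter (fun i => ¬ h i = 0), e i * q ^ (h i - 1) := by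
      rw [← Finset.sum_filter_add_sum_filter_not B (fun i => h i = 0), Finset.mul_sum]
      congr 1
      · refine Finset.sum_congr rfl fun i hi => ?_
        simp [(Finset.mem_filter.1 hi).2]
      · refine Finset.sum_congr rfl fun i hi => ?_
        obtain ⟨k, hk⟩ := Nat.exists_eq_succ_of_ne_zero (Finset.mem_filter.1 hi).2
        rw [hk, Nat.succ_sub_one, pow_succ]
        ring
    obtain ⟨c, hc⟩ := hdvd
    set τ := ∑ i ∈ B.filter (fun i => ¬ h i = 0), e i * (q : ℤ) ^ (h i - 1) with hτ
    rw [hsum] at hc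
    obtain ⟨w', hw'⟩ : ∃ w', w' = (q : ℤ) ^ L * c + (q - 1) * τ := ⟨_, rfl⟩
    have hww : q * w' = w - (q - 1) * σ := by rw [hw']; linear_combination -hc
    have hnd : ¬ ((q : ℤ) - 1) ∣ w' := by
      rintro ⟨k, hk⟩
      exact hw ⟨q * k + σ, by rw [hk] at hww; linear_combination -hww⟩
    have key := ih (B.filter fun i => ¬ h i = 0) (fun i => h i - 1)
      (fun i hi => he i (Finset.mem_filter.1 hi).1) w' hnd ⟨c, by rw [hw']; ring⟩
    have hcard : ((B.filter fun i => h i = 0).card : ℤ) +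
        (B.filter fun i => ¬ h i = 0).card = B.card := by
      exact_mod_cast Finset.card_filter_add_card_filter_not (s := B) fun i => h i = 0
    have hσb : |σ| ≤ (B.filter fun i => h i = 0).card * q := by
      refine (Finset.abs_sum_le_sum_abs _ _).trans ?_
      rw [← nsmul_eq_mul]
      exact Finset.sum_le_card_nsmul _ _ _ fun i hi => he i (Finset.mem_filter.1 hi).1
    generalize ((B.filter fun i => h i = 0).card : ℤ) = m at *
    have hb : q * |w'| ≤ |w| + (q - 1) * (m * q) := by
      have h1 : (q : ℤ) * |w'| = |w - (q - 1) * σ| := by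
        rw [← hww, abs_mul, abs_of_nonneg (by omega : (0 : ℤ) ≤ q)]
      have h2 : |w - (q - 1) * σ| ≤ |w| + |(q - 1) * σ| := abs_sub _ _
      rw [abs_mul, abs_of_nonneg (by omega : (0 : ℤ) ≤ q - 1)] at h2
      have h3 := mul_le_mul_of_nonneg_left hσb (by omega : (0 : ℤ) ≤ q - 1)
      linarith
    have e1 := Int.mul_ediv_add_emod |w| (q - 1)
    have e2 := Int.mul_ediv_add_emod |w'| (q - 1)
    have l1 := Int.emod_lt_of_pos |w| (by omega : (0 : ℤ) < q - 1)
    -- The nonzero remainder, multiplied by q, exceeds the old remainder; this makes `hlt` strict.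
    have l2 : 0 < |w'| % ((q : ℤ) - 1) := by
      refine lt_of_le_of_ne (Int.emod_nonneg _ (by omega)) fun h0 => hnd ?_
      exact (dvd_abs _ _).1 (Int.dvd_of_emod_eq_zero h0.symm)
    have hf : 0 ≤ |w| / ((q : ℤ) - 1) := Int.ediv_nonneg (abs_nonneg _) (by omega)
    generalize |w| / ((q : ℤ) - 1) = f at *
    generalize |w'| / ((q : ℤ) - 1) = f' at *
    generalize |w| % ((q : ℤ) - 1) = r at *
    generalize |w'| % ((q : ℤ) - 1) = r' at *
    have hlt : ((q : ℤ) - 1) * (q * f') < (q - 1) * (f + m * q) := by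
      rw [← e1, ← e2] at hb
      nlinarith
    have hlt' := lt_of_mul_lt_mul_left hlt (by omega)
    have : f' < m + f := by
      by_contra hcon
      nlinarith
    push_cast
    omega

/-- The size of a set of vertices as a signed sum over its vertex-border: `a` counts the children
of a border vertex that lie in the set, and `p` tells whether its parent does. -/
theorem exists_card_eq_sum_vertexBorder {q d : ℕ} (S : Finset (CompleteTreeVertex q d)) :
    ∃ (g : ℤ) (a p : CompleteTreeVertex q d → ℤ), (g = 0 ∨ g = 1) ∧
      (∀ v, 0 ≤ a v ∧ a v ≤ q) ∧ (∀ v, p v = 0 ∨ p v = 1) ∧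
      (S.card : ℤ) = g * treeSize q (d + 1) + ∑ v ∈ vertexBorder (completeTree q d) S,
        (a v * treeSize q (d - v.1.length) - p v * treeSize q (d + 1 - v.1.length)) := by
  classical
  set B := vertexBorder (completeTree q d) S with hB
  set inS : List (Fin q) → Prop := fun w => ∃ v ∈ S, v.1 = w with hinS
  set inB : List (Fin q) → Prop := fun w => ∃ v ∈ B, v.1 = w with hinB
  set g : List (Fin q) → ℤ := fun w => if inS w then 1 else 0 with hg
  set β : List (Fin q) → ℤ := fun w => if inB w then 1 else 0 with hβ
  have g01 : ∀ w, g w = 0 ∨ g w = 1 := fun w => by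
    by_cases h : inS w <;> simp [hg, h]
  have memS : ∀ v : CompleteTreeVertex q d, inS v.1 ↔ v ∈ S := fun v =>
    ⟨fun ⟨u, hu, e⟩ => Subtype.ext e ▸ hu, fun h => ⟨v, h, rfl⟩⟩
  have memB : ∀ v : CompleteTreeVertex q d, inB v.1 ↔ v ∈ B := fun v =>
    ⟨fun ⟨u, hu, e⟩ => Subtype.ext e ▸ hu, fun h => ⟨v, h, rfl⟩⟩
  have memB' : ∀ v : CompleteTreeVertex q d,
      v ∈ B ↔ v ∉ S ∧ ∃ u ∈ S, (completeTree q d).Adj v u := fun v => by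
    simp [hB, vertexBorder]
  have hcard : (S.card : ℤ) = ∑ w ∈ words q d, g w := by
    rw [← sum_completeTreeVertex]
    simp [hg, memS]
  set p : List (Fin q) → ℤ := fun w => match w with
    | [] => 0
    | _ :: w => g w with hp
  have hlocal : ∀ v ∈ words q d, (treeSize q (d - v.length) : ℤ) *
      (if v.length < d then ∑ a, g (a :: v) - q * g v else 0) =
      β v * ((∑ a, g (a :: v)) * treeSize q (d - v.length)) -
      (if v.length < d then ∑ a, β (a :: v) * (g v * treeSize q (d - v.length)) else 0) := by
    intro v hv
    rw [mem_words] at hv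
    split_ifs with hlt
    · rw [← Finset.sum_mul]
      have hch : ∀ a : Fin q, (a :: v).length ≤ d := fun a => by simpa using hlt
      -- If `v` is in S, its children outside S are exactly its border children; if `v` is neither
      -- in S nor in the border, no child is in S.
      have key : ∑ a, g (a :: v) - q * g v = β v * ∑ a, g (a :: v) - (∑ a, β (a :: v)) * g v := by
        by_cases hvS : inS v
        · have hvB : ¬ inB v := fun h =>
            ((memB' ⟨v, hv⟩).1 ((memB ⟨v, hv⟩).1 h)).1 ((memS ⟨v, hv⟩).1 hvS)
          have : ∀ a : Fin q, β (a :: v) = 1 - g (a :: v) := by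
            intro a
            have h1 : inB (a :: v) ↔ ¬ inS (a :: v) := by
              rw [memB ⟨a :: v, hch a⟩, memB', ← memS]
              exact ⟨fun h => h.1, fun h => ⟨h, ⟨v, hv⟩, (memS ⟨v, hv⟩).1 hvS, Or.inr ⟨a, rfl⟩⟩⟩
            by_cases h2 : inS (a :: v) <;> simp [hβ, hg, h1, h2]
          simp only [this, Finset.sum_sub_distrib]
          simp [hβ, hvB, hg, hvS]
        · by_cases hvB : inB v
          · simp [hβ, hvB, hg, hvS]
          · have : ∀ a : Fin q, g (a :: v) = 0 := by
              intro a
              have : ¬ inS (a :: v) := fun h => hvB <| (memB ⟨v, hv⟩).2 <| (memB' _).2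
                ⟨fun h' => hvS ((memS ⟨v, hv⟩).2 h'), ⟨a :: v, hch a⟩,
                  (memS ⟨a :: v, hch a⟩).1 h, Or.inl ⟨a, rfl⟩⟩
              simp [hg, this]
            rw [Finset.sum_eq_zero fun a _ => this a]
            simp [hβ, hvB, hg, hvS]
      rw [key]
      ring
    · rw [Nat.sub_eq_zero_of_le (by omega)]
      simp [treeSize]
  have hpar := sum_words_eq_sum_children (d := d)
    fun w => β w * (p w * (treeSize q (d + 1 - w.length) : ℤ))
  simp only [hp, List.length_cons, Nat.add_sub_add_right, zero_mul, mul_zero, zero_add] at hpar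
  refine ⟨g [], fun v => ∑ a, g (a :: v.1), fun v => p v.1, g01 _, fun v => ⟨?_, ?_⟩, fun v => ?_,
    ?_⟩
  · exact Finset.sum_nonneg fun a _ => by rcases g01 (a :: v.1) with h | h <;> simp [h]
  · refine (Finset.sum_le_card_nsmul _ _ 1 fun a _ => ?_).trans (by simp)
    rcases g01 (a :: v.1) with h | h <;> simp [h]
  · rcases v with ⟨_ | ⟨a, w⟩, hw⟩
    · exact Or.inl rfl
    · exact g01 w
  · rw [hcard, sum_words_telescope, Finset.sum_congr rfl hlocal, Finset.sum_sub_distrib, ← hpar,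
      ← Finset.sum_sub_distrib, ← sum_completeTreeVertex]
    congr 1
    refine (Finset.sum_subset_zero_on_sdiff (Finset.subset_univ B) (fun v hv => ?_)
      fun v hv => ?_).symm
    · simp [hβ, memB, (Finset.mem_sdiff.1 hv).2]
    · simp only [hβ, memB, hv, if_true, one_mul]
      rfl

/-- Border vertices of height below `K` cannot be controlled by divisibility, but each shifts the
quotient by q^K by at most q - 1. They therefore pay for themselves in the term |w| / (q - 1) of
`le_card_add_of_dvd`. -/
theorem le_card_vertexBorder {q d K s : ℕ} (hq : 3 ≤ q) (hd : 1 ≤ d) (hK : 2 * q * d ≤ q ^ K)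
    (hs : s = q ^ (d + 1) / (q - 1) ^ 2) (S : Finset (CompleteTreeVertex q d))
    (hS : S.card = s) : d + 1 ≤ (vertexBorder (completeTree q d) S).card + K := by
  by_contra! hcon
  obtain ⟨g, a, p, hg, ha, hp, hcard⟩ := exists_card_eq_sum_vertexBorder S
  set B := vertexBorder (completeTree q d) S
  have hq' : (3 : ℤ) ≤ q := by exact_mod_cast hq
  have hqK : (0 : ℤ) < (q : ℤ) ^ K := by positivity
  set e : CompleteTreeVertex q d → ℤ := fun v => a v - q * p v with he
  set h : CompleteTreeVertex q d → ℕ := fun v => d - v.1.length with hh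
  have heq : ∀ v ∈ B, |e v| ≤ q := fun v _ => by
    obtain ⟨h1, h2⟩ := ha v
    rcases hp v with h3 | h3 <;> simp only [he, h3, abs_le] <;> constructor <;> linarith
  set E := g + ∑ v ∈ B, (a v - p v) with hE
  have hrep : ((q : ℤ) - 1) * s + E = g * q ^ (d + 1) + ∑ v ∈ B, e v * q ^ h v := by
    have h1 := sub_one_mul_treeSize q (d + 1)
    rw [← hS, hcard, mul_add, Finset.mul_sum, hE]
    have : ∀ v ∈ B, ((q : ℤ) - 1) * (a v * treeSize q (d - v.1.length) -
        p v * treeSize q (d + 1 - v.1.length)) = e v * q ^ h v - (a v - p v) := by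
      intro v _
      have h2 := sub_one_mul_treeSize q (d - v.1.length)
      have h3 := sub_one_mul_treeSize q (d + 1 - v.1.length)
      rw [Nat.succ_sub v.2, pow_succ] at *
      simp only [he, hh]
      linear_combination a v * h2 - p v * h3
    rw [Finset.sum_congr rfl this, Finset.sum_sub_distrib]
    linear_combination g * h1
  have hK1 : 1 ≤ K := by
    rcases Nat.eq_zero_or_pos K with rfl | h0
    · have : 3 * 1 ≤ q * d := Nat.mul_le_mul hq hd
      simp only [pow_zero] at hK
      nlinarith
    · exact h0
  have hbd : (B.card : ℤ) ≤ d - 1 := by omega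
  have hE1 : |E| ≤ q * (d - 1) + 1 := by
    have h1 : |∑ v ∈ B, (a v - p v)| ≤ B.card * q := by
      refine (Finset.abs_sum_le_sum_abs _ _).trans ?_
      rw [← nsmul_eq_mul]
      refine Finset.sum_le_card_nsmul _ _ _ fun v _ => ?_
      obtain ⟨h1, h2⟩ := ha v
      rcases hp v with h3 | h3 <;> simp only [h3, abs_le] <;> constructor <;> linarith
    have h2 : |g| ≤ 1 := by rcases hg with h | h <;> simp [h]
    have h3 := abs_add_le g (∑ v ∈ B, (a v - p v))
    have h4 := mul_le_mul_of_nonneg_right hbd (by omega : (0 : ℤ) ≤ q)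
    rw [hE]
    linarith
  -- ω collects the rounding in `s` and the error `E`; modulo q - 1 it is -1.
  obtain ⟨ω, hω⟩ : ∃ ω : ℤ, ω = (q - 1) * ((q - 1) * s + E) - q ^ (d + 1) := ⟨_, rfl⟩
  have hωlt : |ω| < (q - 1) * q ^ K := by
    have hsl : ((q : ℤ) - 1) ^ 2 * s ≤ q ^ (d + 1) ∧
        (q : ℤ) ^ (d + 1) < (q - 1) ^ 2 * s + (q - 1) ^ 2 := by
      have hpos : 0 < (q - 1) ^ 2 := pow_pos (by omega) 2
      have h1 := Nat.mul_div_le (q ^ (d + 1)) ((q - 1) ^ 2)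
      have h2 := Nat.lt_mul_div_succ (q ^ (d + 1)) hpos
      rw [← hs] at h1 h2
      zify [(by omega : 1 ≤ q)] at h1 h2
      exact ⟨h1, by linarith⟩
    have hK' : 2 * (q : ℤ) * d ≤ q ^ K := by exact_mod_cast hK
    have hd' : (1 : ℤ) ≤ d := by exact_mod_cast hd
    obtain ⟨h1, h2⟩ := abs_le.1 hE1
    have h3 := mul_le_mul_of_nonneg_left h1 (by omega : (0 : ℤ) ≤ q - 1)
    have h4 := mul_le_mul_of_nonneg_left h2 (by omega : (0 : ℤ) ≤ q - 1)
    have h5 := mul_le_mul_of_nonneg_left hK' (by omega : (0 : ℤ) ≤ q - 1)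
    have h6 : 0 < ((q : ℤ) - 1) * (q * d) := mul_pos (by omega) (mul_pos (by omega) (by omega))
    rw [hω, abs_lt]
    constructor <;> nlinarith
  have hnd : ¬ ((q : ℤ) - 1) ∣ ω := by
    rintro ⟨k, hk⟩
    have h1 : ((q : ℤ) - 1) ∣ q ^ (d + 1) := ⟨(q - 1) * s + E - k, by rw [hω] at hk; linear_combination -hk⟩
    have h2 : ((q : ℤ) - 1) ∣ q ^ (d + 1) - 1 := ⟨_, (sub_one_mul_treeSize q (d + 1)).symm⟩
    have h3 := Int.le_of_dvd one_pos (by simpa using dvd_sub h1 h2 : ((q : ℤ) - 1) ∣ 1)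
    omega
  have hsplit := Finset.sum_filter_add_sum_filter_not B (fun v => h v < K) fun v => e v * (q : ℤ) ^ h v
  have hcardsplit : ((B.filter fun v => h v < K).card : ℤ) +
      (B.filter fun v => ¬ h v < K).card = B.card := by
    exact_mod_cast Finset.card_filter_add_card_filter_not (s := B) fun v => h v < K
  set σ := ∑ v ∈ B.filter (fun v => h v < K), e v * (q : ℤ) ^ h v with hσ
  set τ := ∑ v ∈ B.filter (fun v => ¬ h v < K), e v * (q : ℤ) ^ (h v - K) with hτ
  have hhigh : ∑ v ∈ B.filter (fun v => ¬ h v < K), e v * (q : ℤ) ^ h v = q ^ K * τ := by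
    rw [hτ, Finset.mul_sum]
    refine Finset.sum_congr rfl fun v hv => ?_
    rw [mul_left_comm, ← pow_add, Nat.add_sub_cancel' (not_lt.1 (Finset.mem_filter.1 hv).2)]
  have hσle : |σ| ≤ (B.filter fun v => h v < K).card * (q : ℤ) ^ K := by
    refine (Finset.abs_sum_le_sum_abs _ _).trans ?_
    rw [← nsmul_eq_mul]
    refine Finset.sum_le_card_nsmul _ _ _ fun v hv => ?_
    obtain ⟨hv1, hv2⟩ := Finset.mem_filter.1 hv
    rw [abs_mul, abs_of_nonneg (by positivity : (0 : ℤ) ≤ q ^ h v)]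
    calc |e v| * (q : ℤ) ^ h v ≤ q * q ^ h v :=
          mul_le_mul_of_nonneg_right (heq v hv1) (by positivity)
      _ = q ^ (h v + 1) := by ring
      _ ≤ q ^ K := pow_le_pow_right₀ (by omega) hv2
  rw [← hsplit, hhigh] at hrep
  obtain ⟨L, hL⟩ : ∃ L, d + 1 = K + L := ⟨d + 1 - K, by omega⟩
  -- This is ω minus the low terms, divided by q^K (`hwω`).
  obtain ⟨w, hw⟩ : ∃ w : ℤ, w = ((q - 1) * g - 1) * q ^ L + (q - 1) * τ := ⟨_, rfl⟩
  have hwω : (q : ℤ) ^ K * w = ω - (q - 1) * σ := by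
    rw [hω, hrep, hw, hL, pow_add]
    ring
  have key := le_card_add_of_dvd hq L (B.filter fun v => ¬ h v < K) e (fun v => h v - K)
    (fun v hv => heq v (Finset.mem_filter.1 hv).1) w
    (by
      rintro ⟨k, hk⟩
      exact hnd ⟨q ^ K * k + σ, by rw [hk] at hwω; linear_combination -hwω⟩)
    ⟨(q - 1) * g - 1, by rw [hw, hτ]; ring⟩
  generalize ((B.filter fun v => h v < K).card : ℤ) = m at *
  have hwlt : |w| < (q - 1) * (m + 1) := by
    have h1 : (q : ℤ) ^ K * |w| = |ω - (q - 1) * σ| := by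
      rw [← hwω, abs_mul, abs_of_pos hqK]
    have h2 : |ω - (q - 1) * σ| ≤ |ω| + |(q - 1) * σ| := abs_sub _ _
    rw [abs_mul, abs_of_nonneg (by omega : (0 : ℤ) ≤ q - 1)] at h2
    have h3 := mul_le_mul_of_nonneg_left hσle (by omega : (0 : ℤ) ≤ q - 1)
    refine lt_of_mul_lt_mul_left (a := (q : ℤ) ^ K) ?_ hqK.le
    linarith
  have hdiv : |w| / ((q : ℤ) - 1) < m + 1 :=
    Int.ediv_lt_of_lt_mul (by omega) (by rw [mul_comm]; exact hwlt)
  omega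

/-! ### The upper bound -/

/-- In the complete `q`-ary tree with `h + 1` layers there are `r` vertices, among them the root
if and only if `x = 1`, that a set of `b` other vertices (among them the root if and only if
`x = 0`) separates from the rest. Words are read from the root here. -/
def IsReachable (q h : ℕ) (x : SignType) (b : ℕ) (r : ℤ) : Prop :=
  ∃ f : List (Fin q) → SignType, f [] = x ∧
    -- Labels 1, 0, -1 mean in the set, separating, outside; the product is -1 exactly on an edge
    -- joining the set to the outside.
    (∀ w a, w.length < h → f w * f (w ++ [a]) ≠ -1) ∧
    ((words q h).filter fun w => f w = 0).card = b ∧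
    (((words q h).filter fun w => f w = 1).card : ℤ) = r

theorem isReachable_leaf_one (q : ℕ) : IsReachable q 0 1 0 1 :=
  ⟨fun _ => 1, rfl, by simp, by simp, by simp [words]⟩

theorem isReachable_leaf_zero (q : ℕ) : IsReachable q 0 0 1 0 :=
  ⟨fun _ => 0, rfl, by simp, by simp [words], by simp⟩

theorem isReachable_empty (q h : ℕ) : IsReachable q h (-1) 0 0 :=
  ⟨fun _ => -1, rfl, fun _ _ _ => (by decide : (-1 : SignType) * -1 ≠ -1), by simp, by
    simp [(by decide : (-1 : SignType) ≠ 1)]⟩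

theorem isReachable_full (q h : ℕ) : IsReachable q h 1 0 (treeSize q (h + 1)) :=
  ⟨fun _ => 1, rfl, fun _ _ _ => (by decide : (1 : SignType) * 1 ≠ -1), by simp, by simp [card_words]⟩

theorem IsReachable.graft {q h : ℕ} (x : SignType) {y : Fin q → SignType} {b : Fin q → ℕ}
    {r : Fin q → ℤ} (hr : ∀ a, IsReachable q h (y a) (b a) (r a)) (hxy : ∀ a, x * y a ≠ -1) :
    IsReachable q (h + 1) x (∑ a, b a + if x = 0 then 1 else 0)
      (∑ a, r a + if x = 1 then 1 else 0) := by
  choose f hf0 hfadj hfb hfr using hr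
  refine ⟨fun w => match w with
    | [] => x
    | a :: w => f a w, rfl, ?_, ?_, ?_⟩
  · rintro (_ | ⟨a, w⟩) c hw
    · simpa [hf0] using hxy c
    · exact hfadj a w c (by simpa using hw)
  · rw [Finset.card_filter, sum_words_succ, add_comm]
    simp only [← hfb, Finset.card_filter]
  · rw [Finset.card_filter, sum_words_succ, add_comm]
    simp only [← hfr, Finset.card_filter]
    push_cast
    rfl

/-- Graft one tree, `m` copies of a second one and `n` copies of a third one. -/
theorem IsReachable.graft₃ {q h m n : ℕ} (x : SignType) {y y₁ y₂ : SignType} {b b₁ b₂ : ℕ}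
    {r r₁ r₂ : ℤ} (hq : q = m + n + 1) (hr : IsReachable q h y b r)
    (hr₁ : IsReachable q h y₁ b₁ r₁) (hr₂ : IsReachable q h y₂ b₂ r₂) (hxy : x * y ≠ -1)
    (hxy₁ : m = 0 ∨ x * y₁ ≠ -1) (hxy₂ : n = 0 ∨ x * y₂ ≠ -1) :
    IsReachable q (h + 1) x (b + m * b₁ + n * b₂ + if x = 0 then 1 else 0)
      (r + m * r₁ + n * r₂ + if x = 1 then 1 else 0) := by
  subst hq
  have key := IsReachable.graft (q := m + n + 1) (h := h) x
    (y := Fin.snoc (Fin.append (fun _ : Fin m => y₁) (fun _ : Fin n => y₂)) y)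
    (b := Fin.snoc (Fin.append (fun _ : Fin m => b₁) (fun _ : Fin n => b₂)) b)
    (r := Fin.snoc (Fin.append (fun _ : Fin m => r₁) (fun _ : Fin n => r₂)) r)
    (fun a => by
      refine Fin.lastCases ?_ (fun a => ?_) a
      · simpa using hr
      · refine Fin.addCases (fun a => ?_) (fun a => ?_) a
        · simpa using hr₁
        · simp only [Fin.snoc_castSucc, Fin.append_right]
          exact hr₂)
    (fun a => by
      refine Fin.lastCases ?_ (fun a => ?_) a
      · simpa using hxy
      · refine Fin.addCases (fun a => ?_) (fun a => ?_) a
        · rcases hxy₁ with rfl | h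
          · exact a.elim0
          · simpa using h
        · rcases hxy₂ with rfl | h
          · exact a.elim0
          · simp only [Fin.snoc_castSucc, Fin.append_right]
            exact h)
  convert key using 1
  · simp only [Fin.sum_univ_castSucc, Fin.snoc_castSucc, Fin.snoc_last, Fin.sum_univ_add,
      Fin.append_left, Fin.append_right]
    simp
    ring
  · simp only [Fin.sum_univ_castSucc, Fin.snoc_castSucc, Fin.snoc_last, Fin.sum_univ_add,
      Fin.append_left, Fin.append_right]
    simp
    ring

theorem IsReachable.cast {q h b b' : ℕ} {x : SignType} {r r' : ℤ} (hr : IsReachable q h x b r)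
    (hb : b = b') (hr' : r = r') : IsReachable q h x b' r' := by
  subst hb hr'
  exact hr

/-- A border root with `c` full subtrees besides the given one. -/
theorem IsReachable.border {q h c b : ℕ} {y : SignType} {r : ℤ} (hr : IsReachable q h y b r)
    (hc : c + 1 ≤ q) : IsReachable q (h + 1) 0 (b + 1) (r + c * treeSize q (h + 1)) :=
  (hr.graft₃ 0 (m := c) (n := q - 1 - c) (by omega) (isReachable_full q h)
    (isReachable_empty q h) (by simp) (by simp) (by simp)).cast (by simp) (by simp)

theorem isReachable_border {q h c : ℕ} (hq : 1 ≤ q) (hc : c ≤ q) :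
    IsReachable q (h + 1) 0 1 (c * treeSize q (h + 1)) := by
  rcases hc.eq_or_lt with rfl | hc
  · obtain ⟨k, rfl⟩ := Nat.exists_eq_add_of_le' hq
    exact ((isReachable_full (k + 1) h).border (c := k) (by omega)).cast (by simp)
      (by push_cast; ring)
  · exact ((isReachable_empty q h).border (c := c) hc).cast (by simp) (by simp)

theorem exists_isReachable_border (q h : ℕ) (hq : 1 ≤ q) :
    IsReachable q h 0 1 0 ∧ IsReachable q h 0 1 (treeSize q (h + 1) - 1) := by
  cases h with
  | zero => exact ⟨isReachable_leaf_zero q, (isReachable_leaf_zero q).cast rfl (by simp [treeSize])⟩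
  | succ h =>
    exact ⟨(isReachable_border (c := 0) hq (by omega)).cast rfl (by simp),
      (isReachable_border (h := h) (c := q) hq le_rfl).cast rfl (by
        have : treeSize q (h + 1 + 1) = q * treeSize q (h + 1) + 1 := rfl
        rw [this]
        push_cast
        ring)⟩

theorem IsReachable.outer {q h b : ℕ} {r : ℤ} (hr : IsReachable q h 0 b r) (hq : 1 ≤ q) :
    IsReachable q (h + 1) (-1) b r :=
  (hr.graft₃ (-1) (m := 0) (n := q - 1) (by omega) (isReachable_full q h)
    (isReachable_empty q h) (by simp) (by simp) (by right; decide)).cast (by simp)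
    (by simp [(by decide : (-1 : SignType) ≠ 1)])

/-- The extra border vertex is the root of a sibling subtree whose other vertices are all in the
set. Compared with a border root and one full sibling, the size drops by one at equal cost. -/
theorem IsReachable.outer_one {q h b : ℕ} {r : ℤ} (hr : IsReachable q h 0 b r) (hq : 2 ≤ q) :
    IsReachable q (h + 1) (-1) (b + 1) (r + treeSize q (h + 1) - 1) :=
  (hr.graft₃ (-1) (m := 1) (n := q - 2) (by omega) (exists_isReachable_border q h (by omega)).2
    (isReachable_empty q h) (by simp) (by simp) (by right; decide)).cast (by simp)
    (by simp [(by decide : (-1 : SignType) ≠ 1)]; ring)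

theorem IsReachable.inner {q h b : ℕ} {r : ℤ} (hr : IsReachable q h 0 b r) (hq : 1 ≤ q) :
    IsReachable q (h + 1) 1 b (r + (q - 1) * treeSize q (h + 1) + 1) :=
  (hr.graft₃ 1 (m := q - 1) (n := 0) (by omega) (isReachable_full q h)
    (isReachable_empty q h) (by simp) (by right; decide) (by simp)).cast (by simp)
    (by push_cast [Nat.cast_sub hq]; simp)

/-- The extra border vertex is the root of an otherwise empty sibling subtree. Compared with a
border root and q - 2 full siblings, the size grows by one, the root itself, at equal cost. -/
theorem IsReachable.inner_one {q h b : ℕ} {r : ℤ} (hr : IsReachable q h 0 b r) (hq : 2 ≤ q) :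
    IsReachable q (h + 1) 1 (b + 1) (r + (q - 2) * treeSize q (h + 1) + 1) :=
  (hr.graft₃ 1 (m := q - 2) (n := 1) (by omega) (isReachable_full q h)
    (exists_isReachable_border q h (by omega)).1 (by simp) (by right; decide) (by simp)).cast
    (by simp) (by push_cast [Nat.cast_sub hq]; simp)

/-- Labellings read words from the root and tree vertices read them from the leaf end, hence the
reversal. Every border vertex of the resulting set carries label 0, but not conversely. -/
theorem IsReachable.exists_finset {q d b : ℕ} {x : SignType} {s : ℕ}
    (hr : IsReachable q d x b s) : ∃ S : Finset (CompleteTreeVertex q d), S.card = s ∧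
      (vertexBorder (completeTree q d) S).card ≤ b := by
  classical
  obtain ⟨f, -, hadj, hb, hs⟩ := hr
  have hcount : ∀ t : SignType,
      (Finset.univ.filter fun v : CompleteTreeVertex q d => f v.1.reverse = t).card =
      ((words q d).filter fun w => f w = t).card := by
    intro t
    rw [Finset.card_filter,
      sum_completeTreeVertex fun w : List (Fin q) => if f w.reverse = t then 1 else 0,
      ← Finset.card_filter]
    refine Finset.card_bij' (fun w _ => w.reverse) (fun w _ => w.reverse) ?_ ?_ ?_ ?_ <;>
      simp [mem_words]
  refine ⟨Finset.univ.filter fun v => f v.1.reverse = 1, ?_, ?_⟩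
  · rw [hcount]
    exact_mod_cast hs
  · rw [← hb, ← hcount]
    refine Finset.card_le_card fun v hv => ?_
    simp only [vertexBorder, Finset.mem_filter, Finset.mem_univ, true_and] at hv ⊢
    obtain ⟨hv, u, hu, ⟨a, h⟩ | ⟨a, h⟩⟩ := hv
    · have hl : u.1.length ≤ d := u.2
      have := hadj v.1.reverse a (by rw [h, List.length_cons] at hl; simpa using hl)
      rw [← List.reverse_cons, ← h, hu] at this
      revert hv this
      generalize f v.1.reverse = t
      revert t
      decide
    · have hl : v.1.length ≤ d := v.2
      have := hadj u.1.reverse a (by rw [h, List.length_cons] at hl; simpa using hl)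
      rw [← List.reverse_cons, ← h, hu] at this
      revert hv this
      generalize f v.1.reverse = t
      revert t
      decide

/-! ### Extending trees upwards with freedom in the size -/

/-- Every tree of height `h` that reaches `ρ` extends to a tree of height `H` that reaches
`r - r' + ρ + j`, for every `j` between `-m` and `p`, with at most `c` new border vertices. -/
def IsTransition (q h H c p m : ℕ) (r r' : ℤ) : Prop :=
  ∀ (x : SignType) (b : ℕ) (ρ j : ℤ), IsReachable q h x b ρ → -(m : ℤ) ≤ j → j ≤ p →
    ∃ x' b', IsReachable q H x' b' (r - r' + ρ + j) ∧ b' ≤ b + c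

theorem IsTransition.refl (q h : ℕ) (r : ℤ) : IsTransition q h h 0 0 0 r r :=
  fun x b ρ j hr h1 h2 => ⟨x, b, hr.cast rfl (by push_cast at *; omega), le_rfl⟩

theorem IsTransition.trans {q h₁ h₂ h₃ c₁ c₂ p₁ p₂ m₁ m₂ : ℕ} {r₁ r₂ r₃ : ℤ}
    (h23 : IsTransition q h₂ h₃ c₂ p₂ m₂ r₃ r₂) (h12 : IsTransition q h₁ h₂ c₁ p₁ m₁ r₂ r₁) :
    IsTransition q h₁ h₃ (c₁ + c₂) (p₁ + p₂) (m₁ + m₂) r₃ r₁ := by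
  intro x b ρ j hr hm hp
  push_cast at hm hp
  -- The lower transition takes as much of `j` as its range allows.
  obtain ⟨i, hi1, hi2, hi3, hi4⟩ : ∃ i : ℤ, -(m₁ : ℤ) ≤ i ∧ i ≤ p₁ ∧ -(m₂ : ℤ) ≤ j - i ∧
      j - i ≤ p₂ := ⟨max (-(m₁ : ℤ)) (min p₁ j), by omega, by omega, by omega, by omega⟩
  obtain ⟨x', b', hr', hb'⟩ := h12 x b ρ i hr hi1 hi2
  obtain ⟨x'', b'', hr'', hb''⟩ := h23 x' b' _ (j - i) hr' hi3 hi4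
  exact ⟨x'', b'', hr''.cast rfl (by ring), by omega⟩

theorem treeSize_add_le {q : ℕ} (hq : 1 ≤ q) (j i : ℕ) : treeSize q j + i ≤ treeSize q (j + i) := by
  induction i with
  | zero => simp
  | succ i ih =>
    have : treeSize q (j + (i + 1)) = q * treeSize q (j + i) + 1 := rfl
    nlinarith

theorem two_mul_treeSize_lt {q : ℕ} (hq : 3 ≤ q) (j : ℕ) : 2 * treeSize q j < q ^ j := by
  induction j with
  | zero => simp [treeSize]
  | succ j ih =>
    rw [treeSize, pow_succ]
    nlinarith

theorem exists_digit {q : ℕ} (hq : 1 ≤ q) (h : ℕ) {r : ℤ} (h0 : 0 ≤ r) (h1 : r ≤ treeSize q (h + 2)) :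
    r = treeSize q (h + 2) ∨ ∃ (c : ℕ) (r' : ℤ), c + 1 ≤ q ∧ 0 ≤ r' ∧ r' ≤ treeSize q (h + 1) ∧
      r = c * treeSize q (h + 1) + r' := by
  lift r to ℕ using h0
  rcases h1.eq_or_lt with h1 | h1
  · exact Or.inl h1
  have e : treeSize q (h + 2) = q * treeSize q (h + 1) + 1 := rfl
  have hpos : 0 < treeSize q (h + 1) := Nat.succ_pos _
  have hr : r ≤ q * treeSize q (h + 1) := by
    have : r < treeSize q (h + 2) := by exact_mod_cast h1
    omega
  generalize treeSize q (h + 1) = N at *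
  right
  rcases hr.eq_or_lt with hr | hr
  -- The top value q·N has no digit below q, so it is written with digit q - 1 and remainder N.
  · obtain ⟨c, rfl⟩ := Nat.exists_eq_add_of_le' hq
    exact ⟨c, N, le_rfl, by positivity, le_rfl, by rw [hr]; push_cast; ring⟩
  · refine ⟨r / N, (r % N : ℕ), Nat.div_lt_of_lt_mul (by rwa [mul_comm]), by positivity, ?_, ?_⟩
    · exact_mod_cast (Nat.mod_lt r hpos).le
    · exact_mod_cast (Nat.div_add_mod' r N).symm

theorem exists_transition_border {q : ℕ} (hq : 1 ≤ q) (h l : ℕ) {r : ℤ} (h0 : 0 ≤ r)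
    (h1 : r ≤ treeSize q (h + l + 1)) :
    (∃ x b, IsReachable q (h + l) x b r ∧ b ≤ l + 1) ∨
      ∃ r' : ℤ, 0 ≤ r' ∧ r' ≤ treeSize q (h + 1) ∧ IsTransition q h (h + l) l 0 0 r r' := by
  induction l generalizing r with
  | zero => exact Or.inr ⟨r, h0, h1, IsTransition.refl q h r⟩
  | succ l ih =>
    rcases exists_digit hq (h + l) h0 h1 with rfl | ⟨c, r₁, hc, h2, h3, rfl⟩
    · exact Or.inl ⟨1, 0, isReachable_full q _, by omega⟩
    · rcases ih h2 h3 with ⟨x, b, hr, hb⟩ | ⟨r', h4, h5, ht⟩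
      · exact Or.inl ⟨0, b + 1, (hr.border hc).cast rfl (by ring), by omega⟩
      · refine Or.inr ⟨r', h4, h5, fun x b ρ j hr hm hp => ?_⟩
        obtain ⟨x', b', hr', hb'⟩ := ht x b ρ j hr hm hp
        exact ⟨0, b' + 1, (hr'.border hc).cast rfl (by ring), by omega⟩

/-- Two levels, the lower one with a border vertex, either need only one border vertex or allow
for two different sizes. -/
theorem exists_transition_two {q : ℕ} (hq : q = 3 ∨ q = 4) (h : ℕ) {r : ℤ} (h0 : 0 ≤ r)
    (h1 : r ≤ treeSize q (h + 3)) :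
    (∃ x b, IsReachable q (h + 2) x b r ∧ b ≤ 1) ∨
      ∃ (p m : ℕ) (r' : ℤ), p + m ≤ 1 ∧ 0 ≤ r' ∧ r' ≤ treeSize q (h + 1) ∧
        IsTransition q h (h + 2) (1 + p + m) p m r r' := by
  have hq1 : 1 ≤ q := by omega
  rcases exists_digit hq1 (h + 1) h0 h1 with rfl | ⟨c, r₁, hc, h2, h3, rfl⟩
  · exact Or.inl ⟨1, 0, isReachable_full q _, by omega⟩
  replace h3 : r₁ ≤ treeSize q (h + 2) := h3
  rcases eq_or_ne r₁ (treeSize q (h + 2)) with rfl | hne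
  · exact Or.inl ⟨0, 1, (isReachable_border hq1 hc).cast rfl (by push_cast; ring), le_rfl⟩
  rcases Nat.lt_or_ge (c + 1) q with hc' | hc'
  · rcases exists_digit hq1 h h2 h3 with h4 | ⟨c₁, r', hc₁, h4, h5, rfl⟩
    · exact absurd h4 hne
    right
    rcases Nat.eq_zero_or_pos c with rfl | hc0
    · refine ⟨0, 0, r', by omega, h4, h5, fun x b ρ j hr hm hp => ?_⟩
      exact ⟨_, _, ((hr.border hc₁).outer hq1).cast rfl (by push_cast at *; linarith), by omega⟩
    -- Here q ≤ 4 is essential: a middle digit is 1 or q - 2, so a non-border root is compatible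
    -- with one extra border vertex.
    · rcases Nat.lt_or_ge (c + 2) q with hc2 | hc2
      · obtain rfl : c = 1 := by omega
        refine ⟨0, 1, r', by omega, h4, h5, fun x b ρ j hr hm hp => ?_⟩
        obtain rfl | rfl : j = 0 ∨ j = -1 := by push_cast at *; omega
        · exact ⟨_, _, ((hr.border hc₁).border hc).cast rfl (by push_cast; ring), by omega⟩
        · exact ⟨_, _, ((hr.border hc₁).outer_one (by omega)).cast rfl (by push_cast; ring),
            by omega⟩
      · obtain rfl : q = c + 2 := by omega
        refine ⟨1, 0, r', by omega, h4, h5, fun x b ρ j hr hm hp => ?_⟩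
        obtain rfl | rfl : j = 0 ∨ j = 1 := by push_cast at *; omega
        · exact ⟨_, _, ((hr.border hc₁).border hc).cast rfl (by ring), by omega⟩
        · exact ⟨_, _, ((hr.border hc₁).inner_one (by omega)).cast rfl (by push_cast; ring),
            by omega⟩
  · obtain rfl : q = c + 1 := by omega
    rcases h2.eq_or_lt with rfl | h2
    · exact Or.inl ⟨0, 1, (isReachable_border hq1 (c := c) (by omega)).cast rfl (by ring), le_rfl⟩
    rcases exists_digit hq1 h (r := r₁ - 1) (by omega) (by omega) with h4 |
      ⟨c₁, r', hc₁, h4, h5, h6⟩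
    · omega
    refine Or.inr ⟨0, 0, r', by omega, h4, h5, fun x b ρ j hr hm hp => ?_⟩
    refine ⟨_, _, ((hr.border hc₁).inner hq1).cast rfl ?_, by omega⟩
    obtain rfl : j = 0 := by push_cast at *; omega
    rw [sub_eq_iff_eq_add.1 h6]
    push_cast
    ring

theorem exists_transition_even {q : ℕ} (hq : q = 3 ∨ q = 4) (h n : ℕ) {r : ℤ} (h0 : 0 ≤ r)
    (h1 : r ≤ treeSize q (h + 2 * n + 1)) :
    (∃ x b, IsReachable q (h + 2 * n) x b r ∧ b ≤ 2 * n + 1) ∨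
      ∃ (p m : ℕ) (r' : ℤ), p + m ≤ n ∧ 0 ≤ r' ∧ r' ≤ treeSize q (h + 1) ∧
        IsTransition q h (h + 2 * n) (n + p + m) p m r r' := by
  induction n generalizing r with
  | zero => exact Or.inr ⟨0, 0, r, le_rfl, h0, h1, IsTransition.refl q h r⟩
  | succ n ih =>
    rcases exists_transition_two hq (h + 2 * n) h0 h1 with
      ⟨x, b, hr, hb⟩ | ⟨p, m, r₁, hpm, h2, h3, ht⟩
    · exact Or.inl ⟨x, b, hr, by omega⟩
    · rcases ih h2 h3 with ⟨x, b, hr, hb⟩ | ⟨p', m', r', hpm', h4, h5, ht'⟩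
      · obtain ⟨x', b', hr', hb'⟩ := ht x b r₁ 0 hr (by omega) (by omega)
        exact Or.inl ⟨x', b', hr'.cast rfl (by ring), by omega⟩
      · refine Or.inr ⟨p' + p, m' + m, r', by omega, h4, h5, ?_⟩
        convert ht.trans ht' using 1 <;> omega

/-- Round to a multiple of the child subtree size, down if the remainder is at most `p` and up
otherwise; a border root with full subtrees realises any multiple. -/
theorem exists_isReachable_near {q : ℕ} (hq : 1 ≤ q) (h p m : ℕ) {r : ℤ} (h0 : 0 ≤ r)
    (h1 : r ≤ treeSize q (h + 1)) (hpm : treeSize q h ≤ p + m) :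
    ∃ x b ρ j, IsReachable q h x b ρ ∧ b ≤ 1 ∧ -(m : ℤ) ≤ j ∧ j ≤ p ∧ r = ρ + j := by
  cases h with
  | zero =>
    have : treeSize q (0 + 1) = 1 := by simp [treeSize]
    obtain rfl | rfl : r = 0 ∨ r = 1 := by omega
    · exact ⟨_, _, 0, 0, isReachable_leaf_zero q, le_rfl, by omega, by omega, rfl⟩
    · exact ⟨_, _, 1, 0, isReachable_leaf_one q, by omega, by omega, by omega, rfl⟩
  | succ h =>
    rcases exists_digit hq h h0 h1 with rfl | ⟨c, r', hc, h2, h3, rfl⟩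
    · exact ⟨_, _, _, 0, isReachable_full q _, by omega, by omega, by omega, by ring⟩
    · rcases le_or_gt r' p with hp | hp
      · exact ⟨_, _, _, r', isReachable_border hq (c := c) (by omega), le_rfl, by omega, hp, rfl⟩
      · exact ⟨_, _, _, r' - treeSize q (h + 1), isReachable_border hq hc, le_rfl, by omega,
          by omega, by push_cast; ring⟩

/-- A pair of levels without freedom saves a border vertex, so n - (p + m) are saved on the `n`
pairs. The bottom must save only the rest of k - 1, and the freedom p + m suffices for that because
N_(k-1) ≤ n. -/
theorem exists_isReachable {q d k : ℕ} (hq : q = 3 ∨ q = 4) (hk : q ^ k ≤ d) {r : ℤ} (h0 : 0 ≤ r)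
    (h1 : r ≤ treeSize q (d + 1)) : ∃ x b, IsReachable q d x b r ∧ b + k ≤ d + 2 := by
  have hq1 : 1 ≤ q := by omega
  have hkd : k < d := (Nat.lt_pow_self (by omega)).trans_le hk
  obtain ⟨n, h, rfl, hn, hh⟩ : ∃ n h, d = h + 2 * n ∧ treeSize q (k - 1) ≤ n ∧ k ≤ h + 1 := by
    refine ⟨(d - (k - 1)) / 2, d - 2 * ((d - (k - 1)) / 2), by omega, ?_, by omega⟩
    have h2 := two_mul_treeSize_lt (q := q) (by omega) (k - 1)
    have h3 : k - 1 < q ^ (k - 1) := Nat.lt_pow_self (by omega)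
    have h4 : k = 0 ∨ q ^ k = q ^ (k - 1) * q := by
      rcases k with _ | k
      · exact Or.inl rfl
      · exact Or.inr (pow_succ _ _)
    rcases h4 with rfl | h4
    · simp [treeSize]
    · have : q ^ (k - 1) * 3 ≤ q ^ (k - 1) * q := Nat.mul_le_mul_left _ (by omega)
      omega
  rcases exists_transition_even hq h n h0 h1 with ⟨x, b, hr, hb⟩ | ⟨p, m, r₁, hpm, h2, h3, ht⟩
  · exact ⟨x, b, hr, by omega⟩
  obtain ⟨i, l, rfl, hi, hs⟩ : ∃ i l, h = i + l ∧ k + p + m ≤ i + n + 1 ∧ treeSize q i ≤ p + m := by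
    -- The bottom height `i` is the saving still missing, truncated at 0; the `l` levels above it
    -- get one border vertex each.
    refine ⟨k - 1 - (n - (p + m)), h - (k - 1 - (n - (p + m))), by omega, by omega, ?_⟩
    rcases Nat.lt_or_ge (n - (p + m)) (k - 1) with hlt | hge
    · have := treeSize_add_le hq1 (k - 1 - (n - (p + m))) (n - (p + m))
      rw [Nat.sub_add_cancel hlt.le] at this
      omega
    · rw [Nat.sub_eq_zero_of_le hge]
      simp [treeSize]
  obtain ⟨x, b, hr, hb⟩ : ∃ x b, IsReachable q (i + l + 2 * n) x b r ∧
      b ≤ l + 1 + (n + p + m) := by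
    rcases exists_transition_border hq1 i l h2 h3 with ⟨x, b, hr, hb⟩ | ⟨r', h4, h5, ht'⟩
    · obtain ⟨x', b', hr', hb'⟩ := ht x b r₁ 0 hr (by omega) (by omega)
      exact ⟨x', b', hr'.cast rfl (by ring), by omega⟩
    · obtain ⟨x, b, ρ, j, hr, hb, hm, hp, rfl⟩ := exists_isReachable_near hq1 i p m h4 h5 hs
      obtain ⟨x', b', hr', hb'⟩ := ht.trans ht' x b ρ j hr (by push_cast; omega)
        (by push_cast; omega)
      exact ⟨x', b', hr'.cast rfl (by ring), by omega⟩
  exact ⟨x, b, hr, by omega⟩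

/-! ### The bounds on the peak -/

theorem vertexIsoPeak_add_le {q d k : ℕ} (hq : q = 3 ∨ q = 4) (hk : q ^ k ≤ d) :
    vertexIsoPeak (completeTree q d) + k ≤ d + 2 := by
  have hkd : k < d := (Nat.lt_pow_self (by omega)).trans_le hk
  suffices vertexIsoPeak (completeTree q d) ≤ d + 2 - k by omega
  refine Finset.sup_le fun s hs => ?_
  rw [Finset.mem_range, card_completeTreeVertex, Nat.lt_succ_iff] at hs
  obtain ⟨x, b, hr, hb⟩ := exists_isReachable hq hk (r := s) (by positivity) (by exact_mod_cast hs)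
  obtain ⟨S, hS, hSb⟩ := hr.exists_finset
  have h1 : vertexIsoParam (completeTree q d) s ≤ _ := Nat.sInf_le ⟨S, hS, rfl⟩
  exact h1.trans (by omega)

theorem le_vertexIsoPeak_add {q d K : ℕ} (hq : 3 ≤ q) (hd : 1 ≤ d) (hK : 2 * q * d ≤ q ^ K) :
    d + 1 ≤ vertexIsoPeak (completeTree q d) + K := by
  have hs : q ^ (d + 1) / (q - 1) ^ 2 ≤ treeSize q (d + 1) := by
    obtain ⟨n, rfl⟩ := Nat.exists_eq_add_of_le hq
    refine Nat.div_le_of_le_mul ?_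
    have h1 := sub_one_mul_treeSize (3 + n) (d + 1)
    have h2 : (0 : ℤ) < treeSize (3 + n) (d + 1) := by exact_mod_cast Nat.succ_pos _
    rw [show 3 + n - 1 = n + 2 by omega]
    zify
    push_cast at h1 ⊢
    have h3 : (2 : ℤ) ≤ (n + 2) * treeSize (3 + n) (d + 1) := by nlinarith
    nlinarith
  obtain ⟨S₀, -, hS₀⟩ := Finset.exists_subset_card_eq
    (n := q ^ (d + 1) / (q - 1) ^ 2) (s := (Finset.univ : Finset (CompleteTreeVertex q d)))
    (by rwa [Finset.card_univ, card_completeTreeVertex])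
  obtain ⟨S, hS, hSb⟩ := Nat.sInf_mem (s := {k : ℕ | ∃ S : Finset (CompleteTreeVertex q d),
    S.card = q ^ (d + 1) / (q - 1) ^ 2 ∧ (vertexBorder (completeTree q d) S).card = k})
    ⟨_, S₀, hS₀, rfl⟩
  have h1 := le_card_vertexBorder hq hd hK rfl S hS
  have h2 : vertexIsoParam (completeTree q d) (q ^ (d + 1) / (q - 1) ^ 2) ≤
      vertexIsoPeak (completeTree q d) :=
    Finset.le_sup (f := fun s => vertexIsoParam (completeTree q d) s) (by
      rw [Finset.mem_range, card_completeTreeVertex]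
      omega)
  rw [vertexIsoParam, ← hSb] at h2
  omega

theorem theorem1p5 (q d : ℕ) (hq : q = 3 ∨ q = 4) (hd : 1 ≤ d) :
    (∃ ε ∈ Set.Icc (-1 - Real.logb (q : ℝ) 2) (3 : ℝ),
      (vertexIsoPeak (completeTree q d) : ℝ) = (d : ℝ) - Real.logb (q : ℝ) (d : ℝ) + ε) ∧
    (d : ℤ) - ⌈Real.logb (q : ℝ) (2 * (d : ℝ))⌉ ≤ (vertexIsoPeak (completeTree q d) : ℤ) ∧
    (vertexIsoPeak (completeTree q d) : ℤ) ≤ (d : ℤ) - ⌊Real.logb (q : ℝ) (d : ℝ)⌋ + 2 := by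
  have hq1 : 1 < q := by omega
  have hd' : (0 : ℝ) < d := by exact_mod_cast hd
  have lower : (d : ℤ) - ⌈Real.logb (q : ℝ) (2 * (d : ℝ))⌉ ≤ vertexIsoPeak (completeTree q d) := by
    have h1 : ⌈Real.logb (q : ℝ) (2 * (d : ℝ))⌉ = (Nat.clog q (2 * d) : ℤ) := by
      have := Real.ceil_logb_natCast (b := q) (r := ((2 * d : ℕ) : ℝ)) (by positivity)
      rw [Int.clog_natCast] at this
      rw [← this]
      push_cast
      rfl
    have h2 := Nat.le_pow_clog hq1 (2 * d)
    -- The extra 1 in `K` supplies the factor q in 2qd and cancels the 1 in d + 1.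
    have h3 := le_vertexIsoPeak_add (q := q) (d := d) (K := Nat.clog q (2 * d) + 1) (by omega) hd
      (by rw [pow_succ]; nlinarith)
    omega
  have upper : (vertexIsoPeak (completeTree q d) : ℤ) ≤ d - ⌊Real.logb (q : ℝ) (d : ℝ)⌋ + 2 := by
    have h1 : ⌊Real.logb (q : ℝ) (d : ℝ)⌋ = (Nat.log q d : ℤ) := by
      rw [Real.floor_logb_natCast hd'.le, Int.log_natCast]
    have h2 := vertexIsoPeak_add_le hq (Nat.pow_log_le_self q (by omega : d ≠ 0))
    omega
  refine ⟨⟨_, ⟨?_, ?_⟩, (add_sub_cancel _ _).symm⟩, lower, upper⟩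
  · have h1 := Int.ceil_lt_add_one (Real.logb (q : ℝ) (2 * d))
    have h2 : (d : ℝ) - ⌈Real.logb (q : ℝ) (2 * d)⌉ ≤ vertexIsoPeak (completeTree q d) := by
      exact_mod_cast lower
    rw [Real.logb_mul two_ne_zero hd'.ne'] at h1 h2
    linarith
  · have h1 := Int.lt_floor_add_one (Real.logb (q : ℝ) (d : ℝ))
    have h2 : (vertexIsoPeak (completeTree q d) : ℝ) ≤ d - ⌊Real.logb (q : ℝ) (d : ℝ)⌋ + 2 := by
      exact_mod_cast upper
    linarith
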